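/- Let $n,m\in\mathbb{N}=\{1,2,\dots\}$ and let $\emptyset\neq\Omega\subset\mathbb{R}^n$ be an open set of finite Lebesgue measure. Let $W^{k}(\Omega)$ be the space of all $u\in L^2(\Omega)$ (complex-valued) whose weak derivatives $\partial^\alpha u$, $|\alpha|\le k$, exist and belong to $L^2(\Omega)$, with norm $\|u\|_{k,\Omega}=\sum_{|\alpha|\le k}\|\partial^\alpha u\|_{L^2(\Omega)}$, and let $\mathring W^{k}(\Omega)$ be the closure of $C_0^\infty(\Omega)$ in $W^{k}(\Omega)$. Consider in $L^2(\Omega)$ the minimal operator $$A_{min,\Omega,m}:=(-\Delta)^m,\qquad \operatorname{dom}(A_{min,\Omega,m}):=C_0^\infty(\Omega).$$ Then $A_{min,\Omega,m}$ is closable, and its closure $A_{\Omega,m}$ in $L^2(\Omega)$ is given by $$A_{\Omega,m}=(-\Delta)^m,\qquad \operatorname{dom}(A_{\Omega,m})=\mathring W^{2m}(\Omega),$$ where $(-\Delta)^m u$ is taken in the sense of distributions on $\Omega$. In addition, $A_{\Omega,m}$ is strictly positive: it is a densely defined, symmetric, closed operator, and there exists $\varepsilon>0$ such that $A_{\Omega,m}\ge\varepsilon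 I$, i.e. $(f,A_{\Omega,m}f)_{L^2(\Omega)}\ge\varepsilon\|f\|_{L^2(\Omega)}^2$ for all $f\in\mathring W^{2m}(\Omega)$. -/

import Mathlib

open MeasureTheory TopologicalSpace
open scoped Distributions InnerProductSpace ContDiff

noncomputable section

namespace PolyLaplacian

variable {n : ℕ}

/-- The complex Hilbert space `L²(Ω)`, with respect to `n`-dimensional Lebesgue measure on `Ω`. -/
abbrev L2 (Ω : Opens (EuclideanSpace ℝ (Fin n))) : Type :=
  Lp ℂ 2 (volume.restrict (Ω : Set (EuclideanSpace ℝ (Fin n))))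

variable {Ω : Opens (EuclideanSpace ℝ (Fin n))}

/-! ### Classical derivatives of test functions -/

/-- The partial derivative `∂ⱼ` as a linear operator on `C₀^∞(Ω)`. -/
def pderiv (j : Fin n) : Module.End ℂ 𝓓(Ω, ℂ) where
  toFun φ :=
    { toFun := fun x => fderiv ℝ φ x (EuclideanSpace.single j 1)
      contDiff' := (φ.contDiff.fderiv_right (m := ∞) (by simp)).clm_apply contDiff_const
      hasCompactSupport' := φ.hasCompactSupport.fderiv_apply (𝕜 := ℝ) _
      tsupport_subset' := (tsupport_fderiv_apply_subset ℝ _).trans φ.tsupport_subset }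
  map_add' φ ψ := by
    ext x
    have hφ : DifferentiableAt ℝ φ x := (φ.contDiff.differentiable (by simp)) x
    have hψ : DifferentiableAt ℝ ψ x := (ψ.contDiff.differentiable (by simp)) x
    change fderiv ℝ (⇑φ + ⇑ψ) x _ = fderiv ℝ φ x _ + fderiv ℝ ψ x _
    rw [fderiv_add hφ hψ]; rfl
  map_smul' c φ := by
    ext x
    have hφ : DifferentiableAt ℝ φ x := (φ.contDiff.differentiable (by simp)) x
    change fderiv ℝ (c • ⇑φ) x _ = c • fderiv ℝ φ x _
    rw [fderiv_const_smul hφ]; rfl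

/-- `∂^α = ∂₁^{α₁} ⋯ ∂ₙ^{αₙ}` on `C₀^∞(Ω)`, for a multi-index `α`. -/
def mpderiv (α : Fin n → ℕ) : Module.End ℂ 𝓓(Ω, ℂ) :=
  (List.ofFn fun j => pderiv j ^ α j).prod

/-- `-Δ = -∑ⱼ ∂ⱼ²` on `C₀^∞(Ω)`. -/
def negLaplacian : Module.End ℂ 𝓓(Ω, ℂ) :=
  -∑ j : Fin n, pderiv j ^ 2

/-- `-Δ` as defined here is the negative of Mathlib's Laplacian. -/
theorem negLaplacian_apply (φ : 𝓓(Ω, ℂ)) (x : EuclideanSpace ℝ (Fin n)) :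
    negLaplacian φ x = -Laplacian.laplacian (φ : EuclideanSpace ℝ (Fin n) → ℂ) x := by
  have hd (j : Fin n) : (pderiv j ^ 2) φ x
      = iteratedFDeriv ℝ 2 φ x ![EuclideanSpace.single j 1, EuclideanSpace.single j 1] := by
    rw [iteratedFDeriv_two_apply, pow_two]
    change fderiv ℝ (fun y => fderiv ℝ φ y (EuclideanSpace.single j 1)) x
      (EuclideanSpace.single j 1) = _
    have h1 : DifferentiableAt ℝ (fderiv ℝ φ) x :=
      (φ.contDiff.fderiv_right (m := ∞) (by simp)).differentiable (by simp) x
    rw [fderiv_clm_apply h1 (differentiableAt_const _)]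
    simp
  rw [InnerProductSpace.laplacian_eq_iteratedFDeriv_orthonormalBasis _
    (EuclideanSpace.basisFun (Fin n) ℝ)]
  simp [negLaplacian, hd]

/-! ### Test functions as elements of `L²(Ω)`, and the minimal operator -/

theorem memLp_testFunction (φ : 𝓓(Ω, ℂ)) :
    MemLp φ 2 (volume.restrict (Ω : Set (EuclideanSpace ℝ (Fin n)))) :=
  (φ.continuous.memLp_of_hasCompactSupport φ.hasCompactSupport).restrict _

variable (Ω) in
/-- The embedding of `C₀^∞(Ω)` into `L²(Ω)`. -/
def toL2 : 𝓓(Ω, ℂ) →ₗ[ℂ] L2 Ω where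
  toFun φ := (memLp_testFunction φ).toLp φ
  map_add' _ _ := rfl
  map_smul' _ _ := rfl

theorem toL2_injective : Function.Injective (toL2 Ω) := by
  intro φ ψ h
  have hae : φ =ᵐ[volume.restrict (Ω : Set (EuclideanSpace ℝ (Fin n)))] ψ :=
    (MemLp.toLp_eq_toLp_iff (memLp_testFunction φ) (memLp_testFunction ψ)).1 h
  have hon := Measure.eqOn_open_of_ae_eq hae Ω.isOpen φ.continuous.continuousOn
    ψ.continuous.continuousOn
  ext x
  by_cases hx : x ∈ Ω
  · exact hon hx
  · rw [image_eq_zero_of_notMem_tsupport fun h => hx (φ.tsupport_subset h),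
      image_eq_zero_of_notMem_tsupport fun h => hx (ψ.tsupport_subset h)]

variable (Ω) in
/-- The minimal operator `(-Δ)^m` in `L²(Ω)` with domain `C₀^∞(Ω)`. -/
def minimalOperator (m : ℕ) : L2 Ω →ₗ.[ℂ] L2 Ω where
  domain := LinearMap.range (toL2 Ω)
  toFun := toL2 Ω ∘ₗ (negLaplacian ^ m) ∘ₗ
    (LinearEquiv.ofInjective (toL2 Ω) toL2_injective).symm.toLinearMap

/-! ### Weak derivatives and Sobolev spaces -/

/-- `v = ∂^α u` in the sense of distributions on `Ω`. -/
def IsWeakDeriv (α : Fin n → ℕ) (u v : L2 Ω) : Prop :=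
  ∀ φ : 𝓓(Ω, ℂ), ∫ x in (Ω : Set (EuclideanSpace ℝ (Fin n))), u x * mpderiv α φ x
    = (-1) ^ (∑ j, α j) * ∫ x in (Ω : Set (EuclideanSpace ℝ (Fin n))), v x * φ x

/-- A product of an `L²(Ω)` function with a test function is integrable on `Ω`. -/
theorem integrable_mul_testFunction (u : L2 Ω) (φ : 𝓓(Ω, ℂ)) :
    Integrable (fun x => u x * φ x) (volume.restrict (Ω : Set (EuclideanSpace ℝ (Fin n)))) :=
  (Lp.memLp u).integrable_mul (memLp_testFunction φ)

theorem IsWeakDeriv.zero (α : Fin n → ℕ) : IsWeakDeriv α (0 : L2 Ω) 0 := by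
  intro φ
  have h (ψ : 𝓓(Ω, ℂ)) : ∫ x in (Ω : Set (EuclideanSpace ℝ (Fin n))), (0 : L2 Ω) x * ψ x = 0 := by
    rw [integral_congr_ae (g := fun _ => (0 : ℂ)), integral_zero]
    filter_upwards [Lp.coeFn_zero ℂ 2 (volume.restrict (Ω : Set (EuclideanSpace ℝ (Fin n))))]
      with x hx
    rw [hx, Pi.zero_apply, zero_mul]
  rw [h, h, mul_zero]

theorem IsWeakDeriv.add {α : Fin n → ℕ} {u v u' v' : L2 Ω} (h : IsWeakDeriv α u v)
    (h' : IsWeakDeriv α u' v') : IsWeakDeriv α (u + u') (v + v') := by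
  intro φ
  have key (f g : L2 Ω) (ψ : 𝓓(Ω, ℂ)) :
      ∫ x in (Ω : Set (EuclideanSpace ℝ (Fin n))), (f + g) x * ψ x
        = (∫ x in (Ω : Set (EuclideanSpace ℝ (Fin n))), f x * ψ x)
          + ∫ x in (Ω : Set (EuclideanSpace ℝ (Fin n))), g x * ψ x := by
    rw [← integral_add (integrable_mul_testFunction f ψ) (integrable_mul_testFunction g ψ)]
    refine integral_congr_ae ?_
    filter_upwards [Lp.coeFn_add f g] with x hx
    rw [hx, Pi.add_apply, add_mul]
  rw [key, key, h φ, h' φ, mul_add]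

theorem IsWeakDeriv.smul {α : Fin n → ℕ} {u v : L2 Ω} (c : ℂ) (h : IsWeakDeriv α u v) :
    IsWeakDeriv α (c • u) (c • v) := by
  intro φ
  have key (f : L2 Ω) (ψ : 𝓓(Ω, ℂ)) :
      ∫ x in (Ω : Set (EuclideanSpace ℝ (Fin n))), (c • f) x * ψ x
        = c * ∫ x in (Ω : Set (EuclideanSpace ℝ (Fin n))), f x * ψ x := by
    rw [← integral_const_mul]
    refine integral_congr_ae ?_
    filter_upwards [Lp.coeFn_smul c f] with x hx
    rw [hx, Pi.smul_apply, smul_eq_mul, mul_assoc]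
  rw [key, key, h φ, mul_left_comm]

/-- Weak derivatives are unique. -/
theorem IsWeakDeriv.unique {α : Fin n → ℕ} {u v w : L2 Ω} (hv : IsWeakDeriv α u v)
    (hw : IsWeakDeriv α u w) : v = w := by
  have hloc : LocallyIntegrableOn (fun x => v x - w x)
      (Ω : Set (EuclideanSpace ℝ (Fin n))) volume :=
    locallyIntegrableOn_of_locallyIntegrable_restrict
      (((Lp.memLp v).locallyIntegrable one_le_two).sub
        ((Lp.memLp w).locallyIntegrable one_le_two))
  have hae := Ω.isOpen.ae_eq_zero_of_integral_contDiff_smul_eq_zero hloc fun g hg hgc hgΩ => by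
    let φ : 𝓓(Ω, ℂ) :=
      { toFun := fun x => (g x : ℂ)
        contDiff' := Complex.ofRealCLM.contDiff.comp hg
        hasCompactSupport' := hgc.comp_left (g := fun r : ℝ => (r : ℂ)) Complex.ofReal_zero
        tsupport_subset' :=
          (closure_mono (Function.support_comp_subset Complex.ofReal_zero g)).trans hgΩ }
    have hφ (x) : φ x = g x := rfl
    have h1 := (hv φ).symm.trans (hw φ)
    have h2 := mul_left_cancel₀ (pow_ne_zero _ (by norm_num)) h1
    rw [← setIntegral_eq_integral_of_forall_compl_eq_zero
      (s := (Ω : Set (EuclideanSpace ℝ (Fin n))))]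
    · rw [← sub_eq_zero, ← integral_sub (integrable_mul_testFunction v φ)
        (integrable_mul_testFunction w φ)] at h2
      rw [← h2]
      refine integral_congr_ae (Filter.Eventually.of_forall fun x => ?_)
      simp only [hφ, Complex.real_smul]
      ring
    · intro x hx
      rw [image_eq_zero_of_notMem_tsupport fun h => hx (hgΩ h), zero_smul]
  refine Lp.ext ?_
  rw [Filter.EventuallyEq, ae_restrict_iff' Ω.isOpen.measurableSet]
  filter_upwards [hae] with x hx hxΩ
  exact sub_eq_zero.1 (hx hxΩ)

/-- Integration by parts for test functions. -/
theorem integral_mul_pderiv (j : Fin n) (φ ψ : 𝓓(Ω, ℂ)) :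
    ∫ x, φ x * pderiv j ψ x = -∫ x, pderiv j φ x * ψ x := by
  have hi (f g : 𝓓(Ω, ℂ)) : Integrable fun x => f x * g x :=
    (f.continuous.mul g.continuous).integrable_of_hasCompactSupport
      (f.hasCompactSupport.mul_right)
  exact integral_mul_fderiv_eq_neg_fderiv_mul_of_integrable (hi (pderiv j φ) ψ)
    (hi φ (pderiv j ψ)) (hi φ ψ) (fun x _ => φ.contDiff.differentiable (by simp) x)
    (fun x _ => ψ.contDiff.differentiable (by simp) x)

/-- Partial derivatives of test functions commute. -/
theorem pderiv_comm (i j : Fin n) : Commute (pderiv i : Module.End ℂ 𝓓(Ω, ℂ)) (pderiv j) := by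
  have key (i j : Fin n) (φ : 𝓓(Ω, ℂ)) (x) : pderiv i (pderiv j φ) x
      = fderiv ℝ (fderiv ℝ φ) x (EuclideanSpace.single i 1) (EuclideanSpace.single j 1) := by
    change fderiv ℝ (fun y => fderiv ℝ φ y (EuclideanSpace.single j 1)) x
      (EuclideanSpace.single i 1) = _
    have h1 : DifferentiableAt ℝ (fderiv ℝ φ) x :=
      (φ.contDiff.fderiv_right (m := ∞) (by simp)).differentiable (by simp) x
    rw [fderiv_clm_apply h1 (differentiableAt_const _)]
    simp
  refine LinearMap.ext fun φ => TestFunction.ext fun x => ?_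
  change pderiv i (pderiv j φ) x = pderiv j (pderiv i φ) x
  rw [key, key]
  exact φ.contDiff.contDiffAt.isSymmSndFDerivAt
    (by simpa using ENat.LEInfty.out) _ _

/-- Integration by parts for `∂^α` on test functions. -/
theorem integral_mul_mpderiv (α : Fin n → ℕ) (φ ψ : 𝓓(Ω, ℂ)) :
    ∫ x, φ x * mpderiv α ψ x = (-1) ^ (∑ j, α j) * ∫ x, mpderiv α φ x * ψ x := by
  have hpow (j : Fin n) (k : ℕ) (φ ψ : 𝓓(Ω, ℂ)) :
      ∫ x, φ x * (pderiv j ^ k) ψ x = (-1) ^ k * ∫ x, (pderiv j ^ k) φ x * ψ x := by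
    induction k generalizing φ with
    | zero => simp
    | succ k ih =>
      rw [pow_succ', Module.End.mul_apply, integral_mul_pderiv, ih, ← pow_succ', pow_succ,
        pow_succ (pderiv j), Module.End.mul_apply]
      ring
  have hlist (l : List (Fin n)) (φ ψ : 𝓓(Ω, ℂ)) :
      ∫ x, φ x * (l.map fun j => (pderiv j ^ α j : Module.End ℂ 𝓓(Ω, ℂ))).prod ψ x
        = (-1) ^ (l.map α).sum *
          ∫ x, (l.map fun j => (pderiv j ^ α j : Module.End ℂ 𝓓(Ω, ℂ))).prod φ x * ψ x := by
    induction l generalizing φ with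
    | nil => simp
    | cons j l ih =>
      have hc : Commute (pderiv j ^ α j : Module.End ℂ 𝓓(Ω, ℂ))
          (l.map fun j => (pderiv j ^ α j : Module.End ℂ 𝓓(Ω, ℂ))).prod := by
        refine Commute.list_prod_right _ _ fun y hy => ?_
        obtain ⟨i, -, rfl⟩ := List.mem_map.1 hy
        exact (pderiv_comm j i).pow_pow _ _
      simp only [List.map_cons, List.prod_cons, List.sum_cons]
      rw [Module.End.mul_apply, hpow, ih, hc.eq, Module.End.mul_apply, pow_add]
      ring
  have := hlist (List.finRange n) φ ψ
  rwa [← List.ofFn_eq_map, ← List.ofFn_eq_map, List.sum_ofFn] at this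

/-- The weak derivatives of a test function are its classical derivatives. -/
theorem isWeakDeriv_toL2 (α : Fin n → ℕ) (φ : 𝓓(Ω, ℂ)) :
    IsWeakDeriv α (toL2 Ω φ) (toL2 Ω (mpderiv α φ)) := by
  intro ψ
  have key (f g : 𝓓(Ω, ℂ)) :
      ∫ x in (Ω : Set (EuclideanSpace ℝ (Fin n))), toL2 Ω f x * g x = ∫ x, f x * g x := by
    rw [← setIntegral_eq_integral_of_forall_compl_eq_zero (f := fun x => f x * g x)
      (s := (Ω : Set (EuclideanSpace ℝ (Fin n))))]
    · refine integral_congr_ae ?_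
      filter_upwards [(memLp_testFunction f).coeFn_toLp] with x hx
      exact congrArg (· * g x) hx
    · intro x hx
      rw [image_eq_zero_of_notMem_tsupport fun h => hx (f.tsupport_subset h), zero_mul]
  rw [key, key, integral_mul_mpderiv]

open Classical in
/-- The weak derivative `∂^α u ∈ L²(Ω)`; it is only meaningful (and only used below) when
such a weak derivative exists. -/
def weakDeriv (α : Fin n → ℕ) (u : L2 Ω) : L2 Ω :=
  if h : ∃ v, IsWeakDeriv α u v then h.choose else 0

theorem IsWeakDeriv.weakDeriv_eq {α : Fin n → ℕ} {u v : L2 Ω} (h : IsWeakDeriv α u v) :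
    weakDeriv α u = v := by
  have h' : ∃ v, IsWeakDeriv α u v := ⟨v, h⟩
  rw [weakDeriv, dif_pos h']
  exact h'.choose_spec.unique h

variable (Ω) in
/-- The Sobolev space `W^k(Ω) = W^{k,2}(Ω)`: all weak derivatives of order `≤ k` exist
and belong to `L²(Ω)`. -/
def sobolevSpace (k : ℕ) : Submodule ℂ (L2 Ω) where
  carrier := {u | ∀ α : Fin n → ℕ, ∑ j, α j ≤ k → ∃ v, IsWeakDeriv α u v}
  add_mem' hu hv α hα := by
    obtain ⟨u', hu'⟩ := hu α hα
    obtain ⟨v', hv'⟩ := hv α hα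
    exact ⟨_, hu'.add hv'⟩
  zero_mem' α _ := ⟨0, .zero α⟩
  smul_mem' c u hu α hα := by
    obtain ⟨u', hu'⟩ := hu α hα
    exact ⟨_, hu'.smul c⟩

/-- The norm `‖u‖_{k,Ω} = ∑_{|α| ≤ k} ‖∂^α u‖_{L²(Ω)}` of `W^k(Ω)`. -/
def sobolevNorm (k : ℕ) (u : L2 Ω) : ℝ :=
  ∑ l ∈ Finset.range (k + 1), ∑ α ∈ Finset.piAntidiag (Finset.univ : Finset (Fin n)) l,
    ‖weakDeriv α u‖

theorem toL2_mem_sobolevSpace (k : ℕ) (φ : 𝓓(Ω, ℂ)) : toL2 Ω φ ∈ sobolevSpace Ω k :=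
  fun α _ => ⟨_, isWeakDeriv_toL2 α φ⟩

theorem sum_le_of_mem {k l : ℕ} (hl : l ∈ Finset.range (k + 1)) {α : Fin n → ℕ}
    (hα : α ∈ Finset.piAntidiag (Finset.univ : Finset (Fin n)) l) : ∑ j, α j ≤ k := by
  rw [(Finset.mem_piAntidiag.1 hα).1]
  exact Nat.lt_succ_iff.1 (Finset.mem_range.1 hl)

theorem sobolevNorm_add_le {k : ℕ} {u v : L2 Ω} (hu : u ∈ sobolevSpace Ω k)
    (hv : v ∈ sobolevSpace Ω k) : sobolevNorm k (u + v) ≤ sobolevNorm k u + sobolevNorm k v := by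
  simp only [sobolevNorm, ← Finset.sum_add_distrib]
  refine Finset.sum_le_sum fun l hl => Finset.sum_le_sum fun α hα => ?_
  obtain ⟨u', hu'⟩ := hu α (sum_le_of_mem hl hα)
  obtain ⟨v', hv'⟩ := hv α (sum_le_of_mem hl hα)
  rw [(hu'.add hv').weakDeriv_eq, hu'.weakDeriv_eq, hv'.weakDeriv_eq]
  exact norm_add_le _ _

theorem sobolevNorm_smul {k : ℕ} (c : ℂ) {u : L2 Ω} (hu : u ∈ sobolevSpace Ω k) :
    sobolevNorm k (c • u) = ‖c‖ * sobolevNorm k u := by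
  simp only [sobolevNorm, Finset.mul_sum]
  refine Finset.sum_congr rfl fun l hl => Finset.sum_congr rfl fun α hα => ?_
  obtain ⟨u', hu'⟩ := hu α (sum_le_of_mem hl hα)
  rw [(hu'.smul c).weakDeriv_eq, hu'.weakDeriv_eq, norm_smul]

variable (Ω) in
/-- `W̊^k(Ω)`, the closure of `C₀^∞(Ω)` in `W^k(Ω)`. -/
def sobolevSpaceZero (k : ℕ) : Submodule ℂ (L2 Ω) where
  carrier := {u | u ∈ sobolevSpace Ω k ∧
    ∀ ε : ℝ, 0 < ε → ∃ φ : 𝓓(Ω, ℂ), sobolevNorm k (u - toL2 Ω φ) < ε}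
  add_mem' := by
    rintro u v ⟨hu, hu'⟩ ⟨hv, hv'⟩
    refine ⟨add_mem hu hv, fun ε hε => ?_⟩
    obtain ⟨φ, hφ⟩ := hu' (ε / 2) (half_pos hε)
    obtain ⟨ψ, hψ⟩ := hv' (ε / 2) (half_pos hε)
    refine ⟨φ + ψ, ?_⟩
    rw [map_add, add_sub_add_comm]
    have := sobolevNorm_add_le (sub_mem hu (toL2_mem_sobolevSpace k φ))
      (sub_mem hv (toL2_mem_sobolevSpace k ψ))
    linarith
  zero_mem' := by
    refine ⟨zero_mem _, fun ε hε => ⟨0, ?_⟩⟩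
    have := sobolevNorm_smul (k := k) 0 (zero_mem (sobolevSpace Ω k))
    rw [smul_zero, norm_zero, zero_mul] at this
    rwa [map_zero, sub_zero, this]
  smul_mem' := by
    rintro c u ⟨hu, hu'⟩
    refine ⟨Submodule.smul_mem _ c hu, fun ε hε => ?_⟩
    obtain ⟨φ, hφ⟩ := hu' (ε / (‖c‖ + 1)) (by positivity)
    refine ⟨c • φ, ?_⟩
    rw [map_smul, ← smul_sub, sobolevNorm_smul c (sub_mem hu (toL2_mem_sobolevSpace k φ))]
    rw [lt_div_iff₀ (by positivity)] at hφ
    by_cases hc : c = 0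
    · simpa [hc] using hε
    · have h0 : 0 ≤ sobolevNorm k (u - toL2 Ω φ) :=
        Finset.sum_nonneg fun _ _ => Finset.sum_nonneg fun _ _ => norm_nonneg _
      nlinarith

/-- `v = (-Δ)^m u` in the sense of distributions on `Ω`. -/
def IsWeakNegLaplacianPow (m : ℕ) (u v : L2 Ω) : Prop :=
  ∀ φ : 𝓓(Ω, ℂ), ∫ x in (Ω : Set (EuclideanSpace ℝ (Fin n))), u x * (negLaplacian ^ m) φ x
    = ∫ x in (Ω : Set (EuclideanSpace ℝ (Fin n))), v x * φ x

/-! ### Strictly positive operators -/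

/-- A densely defined, symmetric, closed operator `S` in a complex Hilbert space is strictly
positive if `S ≥ ε I` for some `ε > 0`, i.e. `(f, S f) ≥ ε ‖f‖²` for all `f ∈ dom S`. -/
structure IsStrictlyPositiveOperator {H : Type*} [NormedAddCommGroup H] [InnerProductSpace ℂ H]
    (S : H →ₗ.[ℂ] H) : Prop where
  dense_domain : Dense (S.domain : Set H)
  symmetric : S.IsFormalAdjoint S
  closed : S.IsClosed
  lower_bound : ∃ ε : ℝ, 0 < ε ∧
    ∀ f : S.domain, ε * ‖(f : H)‖ ^ 2 ≤ (inner ℂ (f : H) (S f)).re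

end PolyLaplacian

end

open PolyLaplacian

/-! On test functions, extended by zero to all of `ℝⁿ`, Plancherel turns every estimate into a
pointwise comparison of Fourier multipliers: `∂^α` becomes `(2πiξ)^α` and `-Δ` becomes `s = |2πξ|²`.

Domain of the closure: `|(2πξ)^α|² ≤ s^|α| ≤ 1 + s^(2m)` for `|α| ≤ 2m`, and conversely `s^(2m) ≤
n^(2m-1) ∑ⱼ (2πξⱼ)^(4m)`. Hence the graph norm of `(-Δ)^m` and the norm of `W^{2m}` are equivalent
on `C₀^∞(Ω)` (`norm_toL2_mpderiv_le`, `norm_toL2_negLaplacian_pow_le`), so completing in either norm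
gives the same space. No regularity of the boundary is involved.

Closability: the minimal operator is symmetric, as `s` is real, and densely defined, so its adjoint
is a closed extension. The distributional formula, symmetry and the lower bound hold on test
functions and pass to `L²` limits along graph-convergent sequences.

Lower bound (`exists_poincare`): since `Ω` has finite measure, `|φ̂|² ≤ |Ω| ‖φ‖²` everywhere, so a
small ball of frequencies carries at most half of the mass of `φ̂`. Outside a ball of radius `r` the
multiplier `s^m` is at least `(2πr)^(2m)`. -/

namespace PolyLaplacian
open scoped SchwartzMap FourierTransform LineDeriv ComplexConjugate

variable {n : ℕ} {Ω : Opens (EuclideanSpace ℝ (Fin n))}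

/-! ### The Fourier transform of a test function -/

/-- The Fourier transform of a test function. -/
noncomputable def fourierTest (φ : 𝓓(Ω, ℂ)) : 𝓢(EuclideanSpace ℝ (Fin n), ℂ) :=
  𝓕 (φ.hasCompactSupport.toSchwartzMap φ.contDiff)

theorem fourierTest_add (φ ψ : 𝓓(Ω, ℂ)) :
    fourierTest (φ + ψ) = fourierTest φ + fourierTest ψ := by
  rw [fourierTest, fourierTest, fourierTest, ← FourierTransform.fourier_add]
  rfl

theorem fourierTest_smul (c : ℂ) (φ : 𝓓(Ω, ℂ)) :
    fourierTest (c • φ) = c • fourierTest φ := by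
  rw [fourierTest, fourierTest, ← FourierTransform.fourier_smul]
  rfl

/-- The Fourier transform of test functions as a linear map. -/
noncomputable def fourierTestLM : 𝓓(Ω, ℂ) →ₗ[ℂ] 𝓢(EuclideanSpace ℝ (Fin n), ℂ) where
  toFun := fourierTest
  map_add' := fourierTest_add
  map_smul' := fourierTest_smul

theorem fourierTest_pderiv (j : Fin n) (φ : 𝓓(Ω, ℂ)) (ξ : EuclideanSpace ℝ (Fin n)) :
    fourierTest (pderiv j φ) ξ = ((2 * Real.pi * ξ j : ℝ) * Complex.I) * fourierTest φ ξ := by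
  have h : (pderiv j φ).hasCompactSupport.toSchwartzMap (pderiv j φ).contDiff
      = ∂_{EuclideanSpace.single j (1 : ℝ)}
        (φ.hasCompactSupport.toSchwartzMap φ.contDiff) := rfl
  have ht : (fun x : EuclideanSpace ℝ (Fin n) =>
      inner ℝ x (EuclideanSpace.single j (1 : ℝ))).HasTemperateGrowth := by fun_prop
  rw [fourierTest, h, SchwartzMap.fourier_lineDerivOp_eq, smul_apply,
    SchwartzMap.smulLeftCLM_apply_apply ht]
  simp only [EuclideanSpace.inner_single_right, fourierTest, smul_eq_mul, Complex.real_smul]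
  push_cast
  simp
  ring

theorem fourierTest_pderiv_pow (j : Fin n) (k : ℕ) (φ : 𝓓(Ω, ℂ))
    (ξ : EuclideanSpace ℝ (Fin n)) :
    fourierTest ((pderiv j ^ k) φ) ξ
      = ((2 * Real.pi * ξ j : ℝ) * Complex.I) ^ k * fourierTest φ ξ := by
  induction k with
  | zero => simp
  | succ k ih => rw [pow_succ', Module.End.mul_apply, fourierTest_pderiv, ih]; ring

theorem fourierTest_mpderiv (α : Fin n → ℕ) (φ : 𝓓(Ω, ℂ)) (ξ : EuclideanSpace ℝ (Fin n)) :
    fourierTest (mpderiv α φ) ξ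
      = (∏ j, ((2 * Real.pi * ξ j : ℝ) * Complex.I) ^ α j) * fourierTest φ ξ := by
  -- `mpderiv` is an ordered product in a noncommutative ring, so the induction runs over arbitrary
  -- lists of indices.
  have hlist (l : List (Fin n)) :
      fourierTest ((l.map fun j => (pderiv j ^ α j : Module.End ℂ 𝓓(Ω, ℂ))).prod φ) ξ
        = (l.map fun j => ((2 * Real.pi * ξ j : ℝ) * Complex.I) ^ α j).prod
          * fourierTest φ ξ := by
    induction l with
    | nil => simp
    | cons j l ih =>
      rw [List.map_cons, List.prod_cons, List.map_cons, List.prod_cons, Module.End.mul_apply,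
        fourierTest_pderiv_pow, ih, ← mul_assoc]
  rw [mpderiv, List.ofFn_eq_map, hlist, ← List.ofFn_eq_map, List.prod_ofFn]

/-- The Fourier symbol `|2πξ|²` of `-Δ`. -/
noncomputable def symbol (ξ : EuclideanSpace ℝ (Fin n)) : ℝ := ∑ j, (2 * Real.pi * ξ j) ^ 2

theorem symbol_nonneg (ξ : EuclideanSpace ℝ (Fin n)) : 0 ≤ symbol ξ :=
  Finset.sum_nonneg fun _ _ => sq_nonneg _

theorem symbol_eq (ξ : EuclideanSpace ℝ (Fin n)) : symbol ξ = (2 * Real.pi * ‖ξ‖) ^ 2 := by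
  rw [mul_pow, EuclideanSpace.real_norm_sq_eq, Finset.mul_sum]
  exact Finset.sum_congr rfl fun j _ => mul_pow _ _ _

theorem fourierTest_negLaplacian (φ : 𝓓(Ω, ℂ)) (ξ : EuclideanSpace ℝ (Fin n)) :
    fourierTest (negLaplacian φ) ξ = symbol ξ * fourierTest φ ξ := by
  have h : fourierTest (negLaplacian φ) = -∑ j, fourierTest ((pderiv j ^ 2) φ) := by
    change fourierTestLM (negLaplacian φ) = -∑ j, fourierTestLM ((pderiv j ^ 2) φ)
    rw [← map_sum, ← map_neg, negLaplacian, LinearMap.neg_apply, LinearMap.sum_apply]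
  rw [h, neg_apply, sum_apply, symbol, Complex.ofReal_sum,
    Finset.sum_mul, ← Finset.sum_neg_distrib]
  refine Finset.sum_congr rfl fun j _ => ?_
  rw [fourierTest_pderiv_pow, mul_pow, Complex.I_sq]
  push_cast
  ring

theorem fourierTest_negLaplacian_pow (m : ℕ) (φ : 𝓓(Ω, ℂ))
    (ξ : EuclideanSpace ℝ (Fin n)) :
    fourierTest ((negLaplacian ^ m) φ) ξ = (symbol ξ ^ m : ℝ) * fourierTest φ ξ := by
  induction m with
  | zero => simp
  | succ m ih =>
    rw [pow_succ', Module.End.mul_apply, fourierTest_negLaplacian, ih]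
    push_cast
    ring

/-! ### Plancherel's identity -/

theorem integral_restrict_mul_testFunction (f : EuclideanSpace ℝ (Fin n) → ℂ) (φ : 𝓓(Ω, ℂ)) :
    ∫ x in (Ω : Set (EuclideanSpace ℝ (Fin n))), f x * φ x = ∫ x, f x * φ x := by
  refine setIntegral_eq_integral_of_forall_compl_eq_zero fun x hx => ?_
  rw [image_eq_zero_of_notMem_tsupport fun h => hx (φ.tsupport_subset h), mul_zero]

theorem coeFn_toL2 (φ : 𝓓(Ω, ℂ)) :
    toL2 Ω φ =ᵐ[volume.restrict (Ω : Set (EuclideanSpace ℝ (Fin n)))] φ :=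
  (memLp_testFunction φ).coeFn_toLp

/-- Plancherel on `ℝⁿ` applies because test functions vanish outside `Ω`. -/
theorem inner_toL2 (φ ψ : 𝓓(Ω, ℂ)) :
    inner ℂ (toL2 Ω φ) (toL2 Ω ψ)
      = ∫ ξ, conj (fourierTest φ ξ) * fourierTest ψ ξ := by
  have h1 : inner ℂ (toL2 Ω φ) (toL2 Ω ψ) = ∫ x, conj (φ x) * ψ x := by
    rw [L2.inner_def, ← integral_restrict_mul_testFunction]
    refine integral_congr_ae ?_
    filter_upwards [coeFn_toL2 φ, coeFn_toL2 ψ] with x hx hy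
    rw [hx, hy, RCLike.inner_apply, mul_comm]
  have h2 := SchwartzMap.integral_inner_fourier_fourier
    (φ.hasCompactSupport.toSchwartzMap φ.contDiff) (ψ.hasCompactSupport.toSchwartzMap ψ.contDiff)
  simp only [RCLike.inner_apply] at h2
  simp only [fourierTest, h1, mul_comm (conj _), h2]
  rfl

theorem integrable_conj_mul (f g : 𝓢(EuclideanSpace ℝ (Fin n), ℂ)) :
    Integrable fun ξ => conj (f ξ) * g ξ :=
  (f.memLp 2).star.integrable_mul (g.memLp 2)

theorem integrable_norm_sq (f : 𝓢(EuclideanSpace ℝ (Fin n), ℂ)) :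
    Integrable fun ξ => ‖f ξ‖ ^ 2 := (f.memLp 2).integrable_norm_pow (by simp)

theorem norm_sq_toL2 (φ : 𝓓(Ω, ℂ)) : ‖toL2 Ω φ‖ ^ 2 = ∫ ξ, ‖fourierTest φ ξ‖ ^ 2 := by
  have h := inner_toL2 φ φ
  simp only [Complex.conj_mul'] at h
  rw [inner_self_eq_norm_sq_to_K] at h
  norm_cast at h
  exact Complex.ofReal_injective h

/-- The multiplier `symbol ξ ^ m` is real, hence unaffected by conjugation. -/
theorem inner_toL2_negLaplacian_pow (m : ℕ) (φ ψ : 𝓓(Ω, ℂ)) :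
    inner ℂ (toL2 Ω ((negLaplacian ^ m) φ)) (toL2 Ω ψ)
      = inner ℂ (toL2 Ω φ) (toL2 Ω ((negLaplacian ^ m) ψ)) := by
  rw [inner_toL2, inner_toL2]
  congr 1 with ξ
  rw [fourierTest_negLaplacian_pow, fourierTest_negLaplacian_pow, map_mul, Complex.conj_ofReal]
  ring

/-- The integrand is the real part of a product of two Schwartz functions, so no growth bound on the
symbol is needed. -/
theorem integrable_symbol_pow_mul (m : ℕ) (φ : 𝓓(Ω, ℂ)) :
    Integrable fun ξ => symbol ξ ^ m * ‖fourierTest φ ξ‖ ^ 2 := by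
  have h := (integrable_conj_mul (fourierTest φ) (fourierTest ((negLaplacian ^ m) φ))).re
  refine h.congr (.of_forall fun ξ => ?_)
  change (conj _ * _ : ℂ).re = _
  rw [fourierTest_negLaplacian_pow, mul_left_comm, Complex.conj_mul', Complex.re_ofReal_mul]
  norm_cast

theorem re_inner_toL2_negLaplacian_pow (m : ℕ) (φ : 𝓓(Ω, ℂ)) :
    (inner ℂ (toL2 Ω φ) (toL2 Ω ((negLaplacian ^ m) φ))).re
      = ∫ ξ, symbol ξ ^ m * ‖fourierTest φ ξ‖ ^ 2 := by
  have h (ξ) : conj (fourierTest φ ξ) * fourierTest ((negLaplacian ^ m) φ) ξ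
      = ((symbol ξ ^ m * ‖fourierTest φ ξ‖ ^ 2 : ℝ) : ℂ) := by
    rw [fourierTest_negLaplacian_pow, mul_left_comm, Complex.conj_mul']
    push_cast
    rfl
  rw [inner_toL2]
  simp only [h]
  rw [integral_complex_ofReal, Complex.ofReal_re]

theorem norm_sq_fourierTest_negLaplacian_pow (m : ℕ) (φ : 𝓓(Ω, ℂ))
    (ξ : EuclideanSpace ℝ (Fin n)) :
    ‖fourierTest ((negLaplacian ^ m) φ) ξ‖ ^ 2 = symbol ξ ^ (2 * m) * ‖fourierTest φ ξ‖ ^ 2 := by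
  rw [fourierTest_negLaplacian_pow, norm_mul, mul_pow, Complex.norm_real, Real.norm_eq_abs,
    sq_abs, ← pow_mul, mul_comm m]

theorem norm_sq_fourierTest_mpderiv (α : Fin n → ℕ) (φ : 𝓓(Ω, ℂ))
    (ξ : EuclideanSpace ℝ (Fin n)) :
    ‖fourierTest (mpderiv α φ) ξ‖ ^ 2
      = (∏ j, ((2 * Real.pi * ξ j) ^ 2) ^ α j) * ‖fourierTest φ ξ‖ ^ 2 := by
  rw [fourierTest_mpderiv, norm_mul, mul_pow, norm_prod, ← Finset.prod_pow]
  congr 1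
  refine Finset.prod_congr rfl fun j _ => ?_
  rw [norm_pow, norm_mul, Complex.norm_I, mul_one, Complex.norm_real, Real.norm_eq_abs,
    ← pow_mul, mul_comm (α j), pow_mul, sq_abs]

/-! ### A priori estimates -/

/-- Elliptic regularity: derivatives up to order `2m` are controlled by the graph norm. -/
theorem norm_sq_toL2_mpderiv_le {m : ℕ} {α : Fin n → ℕ} (hα : ∑ j, α j ≤ 2 * m)
    (φ : 𝓓(Ω, ℂ)) :
    ‖toL2 Ω (mpderiv α φ)‖ ^ 2 ≤ ‖toL2 Ω φ‖ ^ 2 + ‖toL2 Ω ((negLaplacian ^ m) φ)‖ ^ 2 := by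
  rw [norm_sq_toL2, norm_sq_toL2, norm_sq_toL2,
    ← integral_add (integrable_norm_sq _) (integrable_norm_sq _)]
  refine integral_mono (integrable_norm_sq _)
    ((integrable_norm_sq _).add (integrable_norm_sq _)) fun ξ => ?_
  simp only [norm_sq_fourierTest_mpderiv, norm_sq_fourierTest_negLaplacian_pow]
  have h0 := symbol_nonneg ξ
  -- Each `(2πξⱼ)²` is one of the nonnegative summands of the symbol.
  have h1 : ∏ j, ((2 * Real.pi * ξ j) ^ 2) ^ α j ≤ symbol ξ ^ (∑ j, α j) := by
    rw [← Finset.prod_pow_eq_pow_sum]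
    refine Finset.prod_le_prod (fun j _ => by positivity) fun j _ => ?_
    refine pow_le_pow_left₀ (sq_nonneg _) ?_ _
    exact Finset.single_le_sum (f := fun j => (2 * Real.pi * ξ j) ^ 2)
      (fun _ _ => sq_nonneg _) (Finset.mem_univ j)
  have h2 : symbol ξ ^ (∑ j, α j) ≤ 1 + symbol ξ ^ (2 * m) := by
    rcases le_total (symbol ξ) 1 with h | h
    · have := pow_le_one₀ (n := ∑ j, α j) h0 h
      have := pow_nonneg h0 (2 * m)
      linarith
    · have := pow_le_pow_right₀ h hα
      linarith
  calc _ ≤ (1 + symbol ξ ^ (2 * m)) * ‖fourierTest φ ξ‖ ^ 2 := by gcongr; exact h1.trans h2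
    _ = _ := by ring

theorem norm_toL2_mpderiv_le {m : ℕ} {α : Fin n → ℕ} (hα : ∑ j, α j ≤ 2 * m)
    (φ : 𝓓(Ω, ℂ)) :
    ‖toL2 Ω (mpderiv α φ)‖ ≤ ‖toL2 Ω φ‖ + ‖toL2 Ω ((negLaplacian ^ m) φ)‖ := by
  have := norm_sq_toL2_mpderiv_le hα φ
  refine abs_le_of_sq_le_sq' ?_ (by positivity) |>.2
  nlinarith [norm_nonneg (toL2 Ω φ), norm_nonneg (toL2 Ω ((negLaplacian ^ m) φ))]

/-- Power mean inequality `(∑ aⱼ)^(2m) ≤ n^(2m-1) ∑ aⱼ^(2m)` with `aⱼ = (2πξⱼ)²`. It is the converse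
of the elliptic estimate and needs only the pure derivatives of order `2m`, not the multinomial
expansion of `(-Δ)^m`. -/
theorem norm_sq_toL2_negLaplacian_pow_le {m : ℕ} (hm : 1 ≤ m) (φ : 𝓓(Ω, ℂ)) :
    ‖toL2 Ω ((negLaplacian ^ m) φ)‖ ^ 2
      ≤ (n : ℝ) ^ (2 * m - 1) *
        ∑ j : Fin n, ‖toL2 Ω (mpderiv (Pi.single j (2 * m)) φ)‖ ^ 2 := by
  simp only [norm_sq_toL2]
  rw [← integral_finsetSum _ fun j _ => integrable_norm_sq _, ← integral_const_mul]
  refine integral_mono (integrable_norm_sq _)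
    ((integrable_finsetSum _ fun j _ => integrable_norm_sq _).const_mul _) fun ξ => ?_
  simp only [norm_sq_fourierTest_mpderiv, norm_sq_fourierTest_negLaplacian_pow]
  rw [← Finset.sum_mul, ← mul_assoc]
  gcongr
  have h (j : Fin n) : ∏ i, ((2 * Real.pi * ξ i) ^ 2) ^ (Pi.single j (2 * m) : Fin n → ℕ) i
      = ((2 * Real.pi * ξ j) ^ 2) ^ (2 * m) := by
    rw [Finset.prod_eq_single j (fun i _ hi => by rw [Pi.single_eq_of_ne hi, pow_zero])
      (by simp), Pi.single_eq_same]
  simp only [h]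
  have := pow_sum_le_card_mul_sum_pow (s := Finset.univ)
    (f := fun j => (2 * Real.pi * ξ j) ^ 2) (fun _ _ => sq_nonneg _) (2 * m - 1)
  rwa [Nat.sub_add_cancel (by omega), Finset.card_univ, Fintype.card_fin] at this

theorem norm_toL2_negLaplacian_pow_le {m : ℕ} (hm : 1 ≤ m) (φ : 𝓓(Ω, ℂ)) :
    ‖toL2 Ω ((negLaplacian ^ m) φ)‖
      ≤ √((n : ℝ) ^ (2 * m - 1)) *
        ∑ j : Fin n, ‖toL2 Ω (mpderiv (Pi.single j (2 * m)) φ)‖ := by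
  refine abs_le_of_sq_le_sq' ?_ (by positivity) |>.2
  rw [mul_pow, Real.sq_sqrt (by positivity)]
  refine (norm_sq_toL2_negLaplacian_pow_le hm φ).trans ?_
  gcongr
  exact Finset.sum_sq_le_sq_sum_of_nonneg fun _ _ => norm_nonneg _

/-- `|φ̂(ξ)| ≤ ‖φ‖_{L¹} ≤ |Ω|^{1/2} ‖φ‖_{L²}` by Hölder on `Ω`. This is where finite measure enters.
-/
theorem norm_sq_fourierTest_le (hvol : volume (Ω : Set (EuclideanSpace ℝ (Fin n))) < ⊤)
    (φ : 𝓓(Ω, ℂ)) (ξ : EuclideanSpace ℝ (Fin n)) :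
    ‖fourierTest φ ξ‖ ^ 2
      ≤ volume.real (Ω : Set (EuclideanSpace ℝ (Fin n))) * ‖toL2 Ω φ‖ ^ 2 := by
  have h1 : ‖fourierTest φ ξ‖ ≤ ∫ x, ‖φ x‖ := by
    rw [fourierTest, SchwartzMap.fourier_coe]
    exact VectorFourier.norm_fourierIntegral_le_integral_norm _ _ _ _ _
  have h2 : ∫ x, ‖φ x‖ = ∫ x in (Ω : Set (EuclideanSpace ℝ (Fin n))), ‖φ x‖ := by
    refine (setIntegral_eq_integral_of_forall_compl_eq_zero fun x hx => ?_).symm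
    rw [image_eq_zero_of_notMem_tsupport fun h => hx (φ.tsupport_subset h), norm_zero]
  have h3 := eLpNorm_le_eLpNorm_mul_rpow_measure_univ (p := 1) (q := 2) (by norm_num)
    (memLp_testFunction φ).1
  have h4 : eLpNorm φ 2 (volume.restrict (Ω : Set (EuclideanSpace ℝ (Fin n)))) < ⊤ :=
    (memLp_testFunction φ).2
  have h5 := ENNReal.toReal_mono (ENNReal.mul_ne_top h4.ne
    (ENNReal.rpow_ne_top_of_nonneg (by norm_num) (by simpa using hvol.ne))) h3
  rw [eLpNorm_one_eq_lintegral_enorm, ← integral_norm_eq_lintegral_enorm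
    (memLp_testFunction φ).1, ← h2, ENNReal.toReal_mul, ← ENNReal.toReal_rpow,
    Measure.restrict_apply_univ, ← Lp.norm_toLp _ (memLp_testFunction φ)] at h5
  have h6 : 1 / ENNReal.toReal 1 - 1 / ENNReal.toReal 2 = 1 / 2 := by norm_num
  rw [h6, ← Real.sqrt_eq_rpow] at h5
  have h7 : ‖fourierTest φ ξ‖ ≤ ‖toL2 Ω φ‖ *
      √(volume.real (Ω : Set (EuclideanSpace ℝ (Fin n)))) := h1.trans h5
  calc _ ≤ (‖toL2 Ω φ‖ * √(volume.real (Ω : Set (EuclideanSpace ℝ (Fin n))))) ^ 2 := by gcongr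
    _ = _ := by rw [mul_pow, Real.sq_sqrt measureReal_nonneg, mul_comm]

/-- A Poincaré inequality for `(-Δ)^m` on open sets of finite measure. -/
theorem exists_poincare (hn : 1 ≤ n)
    (hvol : volume (Ω : Set (EuclideanSpace ℝ (Fin n))) < ⊤) (m : ℕ) :
    ∃ ε : ℝ, 0 < ε ∧ ∀ φ : 𝓓(Ω, ℂ), ε * ‖toL2 Ω φ‖ ^ 2
      ≤ (inner ℂ (toL2 Ω φ) (toL2 Ω ((negLaplacian ^ m) φ))).re := by
  set K := volume.real (Ω : Set (EuclideanSpace ℝ (Fin n)))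
  have hK : 0 ≤ K := measureReal_nonneg
  set B := volume.real (Metric.ball (0 : EuclideanSpace ℝ (Fin n)) 1)
  have hB : 0 ≤ B := measureReal_nonneg
  obtain ⟨r, hr0, hr⟩ : ∃ r : ℝ, 0 < r ∧
      volume.real (Metric.ball (0 : EuclideanSpace ℝ (Fin n)) r) * K ≤ 1 / 2 := by
    -- Here `r ≤ 1` and `n ≥ 1` give `r ^ n ≤ r`, so the ball has measure `r ^ n * B ≤ r * B`. The
    -- `+ 1` keeps the denominator positive without knowing that `B * K` is.
    refine ⟨1 / (2 * (B * K + 1)), by positivity, ?_⟩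
    set r := 1 / (2 * (B * K + 1)) with hr
    have hr0 : 0 < r := by positivity
    have hr1 : r ≤ 1 := by
      rw [hr, div_le_one (by positivity)]
      nlinarith [mul_nonneg hB hK]
    have hpow : r ^ n ≤ r := by
      simpa using pow_le_pow_of_le_one hr0.le hr1 hn
    rw [measureReal_def, Measure.addHaar_ball_of_pos _ _ hr0, ENNReal.toReal_mul,
      ENNReal.toReal_ofReal (by positivity), finrank_euclideanSpace_fin]
    change r ^ n * B * K ≤ _
    calc r ^ n * B * K ≤ r * B * K := by gcongr
      _ = r * (B * K) := by ring
      _ ≤ r * (B * K + 1) := by gcongr; linarith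
      _ = 1 / 2 := by rw [hr]; field_simp
  -- The value of `symbol ξ ^ m` on the sphere `‖ξ‖ = r`, hence its minimum outside the ball. At
  -- least half of the mass lies there, which gives the constant `c / 2`.
  set c := ((2 * Real.pi * r) ^ 2) ^ m
  have hc : 0 < c := by have := Real.pi_pos; positivity
  refine ⟨c / 2, by positivity, fun φ => ?_⟩
  rw [re_inner_toL2_negLaplacian_pow]
  set N := ‖toL2 Ω φ‖ ^ 2 with hN
  set b := Metric.ball (0 : EuclideanSpace ℝ (Fin n)) r
  have hi := integrable_norm_sq (fourierTest φ)
  -- The integrand is at most `K * N`, and `r` was chosen so that `K` times the measure of `b` is at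
  -- most `1 / 2`.
  have h1 : ∫ ξ in b, ‖fourierTest φ ξ‖ ^ 2 ≤ N / 2 := by
    have := norm_setIntegral_le_of_norm_le_const (μ := volume) (s := b)
      (f := fun ξ => ‖fourierTest φ ξ‖ ^ 2) (C := K * N) measure_ball_lt_top
      (fun ξ _ => by
        rw [Real.norm_of_nonneg (sq_nonneg _)]; exact norm_sq_fourierTest_le hvol φ ξ)
    refine (le_abs_self _).trans (this.trans ?_)
    nlinarith [sq_nonneg ‖toL2 Ω φ‖]
  have h2 : (∫ ξ in b, ‖fourierTest φ ξ‖ ^ 2) + ∫ ξ in bᶜ, ‖fourierTest φ ξ‖ ^ 2 = N := by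
    rw [integral_add_compl measurableSet_ball hi, hN, norm_sq_toL2]
  have h3 : c * ∫ ξ in bᶜ, ‖fourierTest φ ξ‖ ^ 2
      ≤ ∫ ξ, symbol ξ ^ m * ‖fourierTest φ ξ‖ ^ 2 := by
    rw [← integral_const_mul]
    refine (setIntegral_mono_on (hi.const_mul c).integrableOn
      (integrable_symbol_pow_mul m φ).integrableOn measurableSet_ball.compl
      fun ξ hξ => ?_).trans (setIntegral_le_integral (integrable_symbol_pow_mul m φ)
        (.of_forall fun ξ => mul_nonneg (pow_nonneg (symbol_nonneg ξ) m) (sq_nonneg _)))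
    have hξ' : r ≤ ‖ξ‖ := by simpa [b] using hξ
    rw [symbol_eq]
    have := Real.pi_pos
    simp only [c]
    gcongr
  nlinarith

open Filter
open scoped Topology

/-! ### Weak derivatives and limits -/

/-- Makes the bilinear distributional pairing visibly continuous in `u`; the `star` undoes the
conjugation in the inner product. -/
theorem integral_mul_eq_inner (u : L2 Ω) (φ : 𝓓(Ω, ℂ)) :
    ∫ x in (Ω : Set (EuclideanSpace ℝ (Fin n))), u x * φ x
      = inner ℂ (star (toL2 Ω φ)) u := by
  rw [L2.inner_def]
  refine integral_congr_ae ?_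
  filter_upwards [Lp.coeFn_star (toL2 Ω φ), coeFn_toL2 φ] with x hx hy
  rw [hx, Pi.star_apply, hy, RCLike.inner_apply, RCLike.star_def, Complex.conj_conj]

theorem tendsto_integral_mul {u : ℕ → L2 Ω} {v : L2 Ω} (h : Tendsto u atTop (𝓝 v))
    (φ : 𝓓(Ω, ℂ)) :
    Tendsto (fun k => ∫ x in (Ω : Set (EuclideanSpace ℝ (Fin n))), u k x * φ x) atTop
      (𝓝 (∫ x in (Ω : Set (EuclideanSpace ℝ (Fin n))), v x * φ x)) := by
  simp only [integral_mul_eq_inner]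
  exact tendsto_const_nhds.inner h

/-- Both sides of the defining identity are `L²`-continuous for a fixed test function, so weak
differentiation is a closed relation. -/
theorem IsWeakDeriv.of_tendsto {α : Fin n → ℕ} {u v : ℕ → L2 Ω} {u' v' : L2 Ω}
    (h : ∀ k, IsWeakDeriv α (u k) (v k)) (hu : Tendsto u atTop (𝓝 u'))
    (hv : Tendsto v atTop (𝓝 v')) : IsWeakDeriv α u' v' := fun φ =>
  tendsto_nhds_unique (tendsto_integral_mul hu (mpderiv α φ))
    (((tendsto_integral_mul hv φ).const_mul _).congr fun k => (h k φ).symm)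

theorem IsWeakDeriv.sub {α : Fin n → ℕ} {u v u' v' : L2 Ω} (h : IsWeakDeriv α u v)
    (h' : IsWeakDeriv α u' v') : IsWeakDeriv α (u - u') (v - v') := by
  have := h.add (h'.smul (-1))
  simpa only [neg_one_smul, ← sub_eq_add_neg] using this

theorem IsWeakDeriv.refl (u : L2 Ω) : IsWeakDeriv 0 u u := by
  intro φ
  have h : mpderiv (0 : Fin n → ℕ) φ = φ := by
    simp [mpderiv, List.ofFn_const]
  simp [h]

theorem norm_weakDeriv_le_sobolevNorm {k : ℕ} {α : Fin n → ℕ} (hα : ∑ j, α j ≤ k) (u : L2 Ω) :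
    ‖weakDeriv α u‖ ≤ sobolevNorm k u := by
  rw [sobolevNorm]
  refine le_trans ?_ (Finset.single_le_sum (f := fun l =>
    ∑ α ∈ Finset.piAntidiag (Finset.univ : Finset (Fin n)) l, ‖weakDeriv α u‖)
    (fun _ _ => Finset.sum_nonneg fun _ _ => norm_nonneg _)
    (Finset.mem_range.2 (Nat.lt_succ_of_le hα)))
  exact Finset.single_le_sum (f := fun α => ‖weakDeriv α u‖) (fun _ _ => norm_nonneg _)
    (Finset.mem_piAntidiag.2 ⟨rfl, by simp⟩)

/-- If `u` is orthogonal to all test functions, then `star u` is a weak derivative of order zero of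
`0`, and uniqueness of weak derivatives forces it to vanish. -/
theorem dense_range_toL2 : Dense (LinearMap.range (toL2 Ω) : Set (L2 Ω)) := by
  rw [Submodule.dense_iff_topologicalClosure_eq_top, Submodule.topologicalClosure_eq_top_iff,
    Submodule.eq_bot_iff]
  intro u hu
  have h : IsWeakDeriv (0 : Fin n → ℕ) (0 : L2 Ω) (star u) := by
    intro φ
    have h1 : ∫ x in (Ω : Set (EuclideanSpace ℝ (Fin n))), (star u) x * φ x = 0 := by
      have h2 : inner ℂ u (toL2 Ω φ) = 0 :=
        (Submodule.mem_orthogonal' _ _).1 hu _ ⟨φ, rfl⟩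
      rw [← h2, L2.inner_def]
      refine integral_congr_ae ?_
      filter_upwards [Lp.coeFn_star u, coeFn_toL2 φ] with x hx hy
      rw [hx, Pi.star_apply, hy, RCLike.inner_apply, RCLike.star_def, mul_comm]
    rw [h1, mul_zero, integral_mul_eq_inner, inner_zero_right]
  have h0 : star u = 0 := h.unique (.zero 0)
  refine (Lp.eq_zero_iff_ae_eq_zero).2 ?_
  filter_upwards [Lp.coeFn_star u, (Lp.eq_zero_iff_ae_eq_zero).1 h0] with x hx hy
  exact star_eq_zero.1 (hx.symm.trans hy)

/-! ### The minimal operator and its closure -/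

theorem minimalOperator_apply {m : ℕ} (u : (minimalOperator Ω m).domain) (φ : 𝓓(Ω, ℂ))
    (h : toL2 Ω φ = u) : minimalOperator Ω m u = toL2 Ω ((negLaplacian ^ m) φ) := by
  have : (LinearEquiv.ofInjective (toL2 Ω) toL2_injective).symm u = φ := by
    exact (LinearEquiv.symm_apply_eq _).2 (Subtype.ext h.symm)
  exact congrArg (fun ψ => toL2 Ω ((negLaplacian ^ m) ψ)) this

theorem mem_graph_minimalOperator {m : ℕ} {p : L2 Ω × L2 Ω} :
    p ∈ (minimalOperator Ω m).graph
      ↔ ∃ φ : 𝓓(Ω, ℂ), (toL2 Ω φ, toL2 Ω ((negLaplacian ^ m) φ)) = p := by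
  constructor
  · intro h
    obtain ⟨u, h1, h2⟩ := (LinearPMap.mem_graph_iff _).1 h
    obtain ⟨φ, hφ⟩ : ∃ φ, toL2 Ω φ = u := u.2
    exact ⟨φ, Prod.ext (hφ.trans h1) ((minimalOperator_apply u φ hφ).symm.trans h2)⟩
  · rintro ⟨φ, rfl⟩
    exact (LinearPMap.mem_graph_iff _).2
      ⟨⟨toL2 Ω φ, φ, rfl⟩, rfl, minimalOperator_apply _ φ rfl⟩

theorem minimalOperator_isFormalAdjoint (m : ℕ) :
    (minimalOperator Ω m).IsFormalAdjoint (minimalOperator Ω m) := by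
  intro u v
  obtain ⟨φ, hφ⟩ : ∃ φ, toL2 Ω φ = u := u.2
  obtain ⟨ψ, hψ⟩ : ∃ φ, toL2 Ω φ = v := v.2
  rw [minimalOperator_apply u φ hφ, minimalOperator_apply v ψ hψ, ← hφ, ← hψ,
    inner_toL2_negLaplacian_pow]

/-- A densely defined symmetric operator is contained in its adjoint, which is closed. -/
theorem minimalOperator_isClosable (m : ℕ) : (minimalOperator Ω m).IsClosable :=
  have hd : Dense ((minimalOperator Ω m).domain : Set (L2 Ω)) := dense_range_toL2
  LinearPMap.isClosable_iff_exists_closed_extension.2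
    ⟨_, LinearPMap.adjoint_isClosed hd, (minimalOperator_isFormalAdjoint m).le_adjoint hd⟩

/-- The graph of the closure is the closure of the graph, and sequences suffice in the metric space
`L² × L²`. All properties of the closure are obtained through these sequences. -/
theorem mem_graph_closure_minimalOperator {m : ℕ} {p : L2 Ω × L2 Ω} :
    p ∈ (minimalOperator Ω m).closure.graph ↔ ∃ φ : ℕ → 𝓓(Ω, ℂ),
      Tendsto (fun k => toL2 Ω (φ k)) atTop (𝓝 p.1) ∧
      Tendsto (fun k => toL2 Ω ((negLaplacian ^ m) (φ k))) atTop (𝓝 p.2) := by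
  rw [← (minimalOperator_isClosable m).graph_closure_eq_closure_graph, ← SetLike.mem_coe,
    Submodule.topologicalClosure_coe, mem_closure_iff_seq_limit]
  constructor
  · rintro ⟨x, hx, hlim⟩
    choose φ hφ using fun k => mem_graph_minimalOperator.1 (hx k)
    have : x = fun k => (toL2 Ω (φ k), toL2 Ω ((negLaplacian ^ m) (φ k))) :=
      funext fun k => (hφ k).symm
    subst this
    exact ⟨φ, (continuous_fst.tendsto p).comp hlim, (continuous_snd.tendsto p).comp hlim⟩
  · rintro ⟨φ, h1, h2⟩
    exact ⟨_, fun k => mem_graph_minimalOperator.2 ⟨φ k, rfl⟩, h1.prodMk_nhds h2⟩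

theorem exists_seq_closure_minimalOperator {m : ℕ} (u : (minimalOperator Ω m).closure.domain) :
    ∃ φ : ℕ → 𝓓(Ω, ℂ), Tendsto (fun k => toL2 Ω (φ k)) atTop (𝓝 (u : L2 Ω)) ∧
      Tendsto (fun k => toL2 Ω ((negLaplacian ^ m) (φ k))) atTop
        (𝓝 ((minimalOperator Ω m).closure u)) :=
  mem_graph_closure_minimalOperator.1 ((minimalOperator Ω m).closure.mem_graph u)

theorem isWeakNegLaplacianPow_toL2 (m : ℕ) (φ : 𝓓(Ω, ℂ)) :
    IsWeakNegLaplacianPow m (toL2 Ω φ) (toL2 Ω ((negLaplacian ^ m) φ)) := by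
  have key (φ ψ : 𝓓(Ω, ℂ)) :
      ∫ x in (Ω : Set (EuclideanSpace ℝ (Fin n))), toL2 Ω φ x * ψ x = ∫ x, φ x * ψ x := by
    rw [← integral_restrict_mul_testFunction]
    refine integral_congr_ae ?_
    filter_upwards [coeFn_toL2 φ] with x hx
    rw [hx]
  -- Two integrations by parts, so the signs cancel.
  have hj (j : Fin n) (φ ψ : 𝓓(Ω, ℂ)) :
      ∫ x, φ x * (pderiv j ^ 2) ψ x = ∫ x, (pderiv j ^ 2) φ x * ψ x := by
    rw [pow_two, Module.End.mul_apply, Module.End.mul_apply, integral_mul_pderiv,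
      integral_mul_pderiv, neg_neg]
  have hi (φ ψ : 𝓓(Ω, ℂ)) : Integrable fun x => φ x * ψ x :=
    (φ.continuous.mul ψ.continuous).integrable_of_hasCompactSupport
      φ.hasCompactSupport.mul_right
  have hΔ (φ ψ : 𝓓(Ω, ℂ)) :
      ∫ x, φ x * negLaplacian ψ x = ∫ x, negLaplacian φ x * ψ x := by
    have h (φ : 𝓓(Ω, ℂ)) (x) : negLaplacian φ x = -∑ j, (pderiv j ^ 2) φ x := by
      simp [negLaplacian]
    simp only [h, mul_neg, neg_mul, Finset.mul_sum, Finset.sum_mul]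
    rw [integral_neg, integral_neg, integral_finsetSum _ fun j _ => hi _ _,
      integral_finsetSum _ fun j _ => hi _ _]
    simp only [hj]
  have hpow (m : ℕ) (φ ψ : 𝓓(Ω, ℂ)) :
      ∫ x, φ x * (negLaplacian ^ m) ψ x = ∫ x, (negLaplacian ^ m) φ x * ψ x := by
    induction m generalizing φ with
    | zero => simp
    | succ m ih =>
      rw [pow_succ', Module.End.mul_apply, hΔ, ih, ← pow_succ', pow_succ, Module.End.mul_apply]
  intro ψ
  rw [key, key, hpow]

theorem IsWeakNegLaplacianPow.closure {m : ℕ} (u : (minimalOperator Ω m).closure.domain) :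
    IsWeakNegLaplacianPow m (u : L2 Ω) ((minimalOperator Ω m).closure u) := by
  obtain ⟨φ, h1, h2⟩ := exists_seq_closure_minimalOperator u
  intro ψ
  exact tendsto_nhds_unique (tendsto_integral_mul h1 _)
    ((tendsto_integral_mul h2 ψ).congr fun k => (isWeakNegLaplacianPow_toL2 m (φ k) ψ).symm)

/-- By the elliptic estimate, a graph-Cauchy sequence of test functions has all derivatives of order
`≤ 2m` Cauchy in `L²`. Their limits are the weak derivatives of `u`, so the sequence converges to
`u` in `W^{2m}`. -/
theorem closure_domain_le_sobolevSpaceZero (m : ℕ) :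
    (minimalOperator Ω m).closure.domain ≤ sobolevSpaceZero Ω (2 * m) := by
  intro u hu
  obtain ⟨φ, h1, h2⟩ := exists_seq_closure_minimalOperator ⟨u, hu⟩
  have hlim (α : Fin n → ℕ) (hα : ∑ j, α j ≤ 2 * m) :
      ∃ w, Tendsto (fun k => toL2 Ω (mpderiv α (φ k))) atTop (𝓝 w) := by
    refine cauchySeq_tendsto_of_complete (cauchySeq_iff_tendsto_dist_atTop_0.2 ?_)
    have h3 := (cauchySeq_iff_tendsto_dist_atTop_0.1 h1.cauchySeq).add
      (cauchySeq_iff_tendsto_dist_atTop_0.1 h2.cauchySeq)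
    rw [add_zero] at h3
    refine squeeze_zero (fun _ => dist_nonneg) (fun p => ?_) h3
    simp only [dist_eq_norm, ← map_sub]
    exact norm_toL2_mpderiv_le hα _
  -- For `|α| > 2m` the values of `w` are arbitrary and never used.
  choose! w hw using hlim
  have hwu (α : Fin n → ℕ) (hα : ∑ j, α j ≤ 2 * m) : IsWeakDeriv α u (w α) :=
    .of_tendsto (fun k => isWeakDeriv_toL2 α (φ k)) h1 (hw α hα)
  refine ⟨fun α hα => ⟨_, hwu α hα⟩, fun ε hε => ?_⟩
  have hlim : Tendsto (fun k => sobolevNorm (2 * m) (u - toL2 Ω (φ k))) atTop (𝓝 0) := by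
    have h0 : (0 : ℝ) = ∑ l ∈ Finset.range (2 * m + 1),
        ∑ α ∈ Finset.piAntidiag (Finset.univ : Finset (Fin n)) l, 0 := by simp
    rw [h0]
    refine tendsto_finsetSum _ fun l hl => tendsto_finsetSum _ fun α hα => ?_
    have hα' := sum_le_of_mem hl hα
    have h (k) : weakDeriv α (u - toL2 Ω (φ k)) = w α - toL2 Ω (mpderiv α (φ k)) :=
      ((hwu α hα').sub (isWeakDeriv_toL2 α (φ k))).weakDeriv_eq
    simp only [h]
    simpa using ((tendsto_const_nhds (x := w α)).sub (hw α hα')).norm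
  obtain ⟨k, hk⟩ := (hlim.eventually_lt_const hε).exists
  exact ⟨φ k, hk⟩

/-- Convergence in `W^{2m}` makes the pure derivatives of order `2m` Cauchy, hence also `(-Δ)^m
φ_k`. Membership in the domain needs only that the latter has some limit, which is not identified
here. -/
theorem sobolevSpaceZero_le_closure_domain {m : ℕ} (hm : 1 ≤ m) :
    sobolevSpaceZero Ω (2 * m) ≤ (minimalOperator Ω m).closure.domain := by
  rintro u ⟨hu, hu'⟩
  choose φ hφ using fun k : ℕ => hu' (1 / ((k : ℝ) + 1)) (by positivity)
  have hlim (α : Fin n → ℕ) (hα : ∑ j, α j ≤ 2 * m) {w : L2 Ω} (hw : IsWeakDeriv α u w) :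
      Tendsto (fun k => toL2 Ω (mpderiv α (φ k))) atTop (𝓝 w) := by
    rw [tendsto_iff_norm_sub_tendsto_zero]
    refine squeeze_zero (fun _ => norm_nonneg _) (fun k => ?_)
      tendsto_one_div_add_atTop_nhds_zero_nat
    rw [norm_sub_rev, ← (hw.sub (isWeakDeriv_toL2 α (φ k))).weakDeriv_eq]
    exact (norm_weakDeriv_le_sobolevNorm hα _).trans (hφ k).le
  have h1 : Tendsto (fun k => toL2 Ω (φ k)) atTop (𝓝 u) := by
    rw [tendsto_iff_norm_sub_tendsto_zero]
    refine squeeze_zero (fun _ => norm_nonneg _) (fun k => ?_)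
      tendsto_one_div_add_atTop_nhds_zero_nat
    -- The `L²` norm is the `α = 0` term of the Sobolev norm.
    rw [norm_sub_rev, ← (IsWeakDeriv.refl (u - toL2 Ω (φ k))).weakDeriv_eq]
    exact (norm_weakDeriv_le_sobolevNorm (by simp) _).trans (hφ k).le
  obtain ⟨v, h2⟩ :
      ∃ v, Tendsto (fun k => toL2 Ω ((negLaplacian ^ m) (φ k))) atTop (𝓝 v) := by
    refine cauchySeq_tendsto_of_complete (cauchySeq_iff_tendsto_dist_atTop_0.2 ?_)
    have h3 : Tendsto (fun p : ℕ × ℕ => √((n : ℝ) ^ (2 * m - 1)) *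
        ∑ j : Fin n, dist (toL2 Ω (mpderiv (Pi.single j (2 * m)) (φ p.1)))
          (toL2 Ω (mpderiv (Pi.single j (2 * m)) (φ p.2)))) atTop (𝓝 0) := by
      have h0 : (0 : ℝ) = √((n : ℝ) ^ (2 * m - 1)) * ∑ j : Fin n, 0 := by simp
      rw [h0]
      refine (tendsto_finsetSum _ fun j _ => ?_).const_mul _
      have hj : ∑ i, (Pi.single j (2 * m) : Fin n → ℕ) i ≤ 2 * m := by simp
      obtain ⟨w, hw⟩ := hu _ hj
      exact cauchySeq_iff_tendsto_dist_atTop_0.1 (hlim _ hj hw).cauchySeq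
    refine squeeze_zero (fun _ => dist_nonneg) (fun p => ?_) h3
    simp only [dist_eq_norm, ← map_sub]
    exact norm_toL2_negLaplacian_pow_le hm _
  exact LinearPMap.mem_domain_of_mem_graph
    (mem_graph_closure_minimalOperator (p := (u, v)).2 ⟨φ, h1, h2⟩)

theorem isStrictlyPositiveOperator_closure (hn : 1 ≤ n)
    (hvol : volume (Ω : Set (EuclideanSpace ℝ (Fin n))) < ⊤) (m : ℕ) :
    IsStrictlyPositiveOperator (minimalOperator Ω m).closure where
  dense_domain := by
    have hd : Dense ((minimalOperator Ω m).domain : Set (L2 Ω)) := dense_range_toL2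
    exact hd.mono (minimalOperator Ω m).le_closure.1
  symmetric := by
    intro u v
    obtain ⟨φ, h1, h2⟩ := exists_seq_closure_minimalOperator u
    obtain ⟨ψ, h3, h4⟩ := exists_seq_closure_minimalOperator v
    exact tendsto_nhds_unique (h2.inner h3)
      ((h1.inner h4).congr fun k => (inner_toL2_negLaplacian_pow m (φ k) (ψ k)).symm)
  closed := (minimalOperator_isClosable m).closure_isClosed
  lower_bound := by
    obtain ⟨ε, hε, h⟩ := exists_poincare (Ω := Ω) hn hvol m
    refine ⟨ε, hε, fun u => ?_⟩
    obtain ⟨φ, h1, h2⟩ := exists_seq_closure_minimalOperator u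
    -- The Poincaré constant does not depend on the test function, so the inequality survives the
    -- limit.
    exact le_of_tendsto_of_tendsto' ((h1.norm.pow 2).const_mul ε)
      ((Complex.continuous_re.tendsto _).comp (h1.inner h2)) fun k => h (φ k)

end PolyLaplacian

theorem theorem3p5 (n : ℕ) (hn : 1 ≤ n)
    (Ω : Opens (EuclideanSpace ℝ (Fin n)))
    (hΩ : (Ω : Set (EuclideanSpace ℝ (Fin n))).Nonempty)
    (hvol : volume (Ω : Set (EuclideanSpace ℝ (Fin n))) < ⊤)
    (m : ℕ) (hm : 1 ≤ m) :
    (minimalOperator Ω m).IsClosable ∧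
    (minimalOperator Ω m).closure.domain = sobolevSpaceZero Ω (2 * m) ∧
    (∀ u : (minimalOperator Ω m).closure.domain,
      IsWeakNegLaplacianPow m (u : L2 Ω) ((minimalOperator Ω m).closure u)) ∧
    IsStrictlyPositiveOperator (minimalOperator Ω m).closure :=
  ⟨minimalOperator_isClosable m,
    le_antisymm (closure_domain_le_sobolevSpaceZero m) (sobolevSpaceZero_le_closure_domain hm),
    IsWeakNegLaplacianPow.closure, isStrictlyPositiveOperator_closure hn hvol m⟩
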